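/- **Corollary D.** Let $n\ge 1$ be an integer and let $k,l$ be integers with $\gcd(n,k,l)=1$. Let $G=G_n(x_0x_kx_l)$ be the cyclically presented group $$G=\langle x_0,\dots,x_{n-1}\mid x_ix_{i+k}x_{i+l}=1\ (0\le i<n)\rangle ,$$ subscripts being taken modulo $n$. Consider the conditions - (A) $n\equiv 0 \pmod 3$ and $k+l\equiv 0\pmod 3$; - (C) $3l\equiv 0$ or $3k\equiv 0$ or $3(l-k)\equiv 0 \pmod n$. For integers $M,N,R,\lambda$ with $M,N\geq 1$ and $R^N\equiv 1 \pmod M$ let $$B(M,N,R,\lambda)=\langle a,b\mid a^M=1,\ bab^{-1}=a^R,\ b^N=a^{\lambda M/\gcd(M,R-1)}\rangle ,$$ and let $\mathbb{Z}_m$ denote the cyclic group of order $m$. Suppose that (C) holds. Then, with congruences between $k$, $l$ and $0$ taken modulo $n$, $$ G\cong \begin{cases} B\left(\frac{2^n-(-1)^n}{3},\,3,\,2^{2n/3},\,1\right) & \text{if (A) does not hold and } k\not\equiv 0,\ l\not\equiv 0,\ k\not\equiv l,\\ \mathbb{Z}_{2^n-(-1)^n} & \text{if } k\equiv 0 \text{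 or } l\equiv 0 \text{ or } k\equiv l,\\ \mathbb{Z}_{(2^{n/3}-(-1)^{n/3})/3} * \mathbb{Z} * \mathbb{Z} & \text{if (A) holds.} \end{cases} $$ (In the first and third cases $n$ is divisible by $3$, and all the quotients written above are positive integers.) -/

import Mathlib

namespace CyclicPres

/-- The shift automorphism `θ` of the free group on `x_i` (`i` modulo `n`): `θ (x_i) = x_{i+1}`. -/
def shift (n : ℕ) : FreeGroup (ZMod n) →* FreeGroup (ZMod n) :=
  FreeGroup.map fun i => i + 1

/-- The relators `w, θ(w), …, θ^{n-1}(w)`. -/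
def relators (n : ℕ) (w : FreeGroup (ZMod n)) : Set (FreeGroup (ZMod n)) :=
  {r | ∃ i < n, r = (shift n)^[i] w}

/-- The cyclically presented group `G_n(w)`. -/
abbrev CyclicGroup (n : ℕ) (w : FreeGroup (ZMod n)) : Type :=
  PresentedGroup (relators n w)

/-- The word `x_0 x_k x_l`, subscripts being read modulo `n`. -/
def word (n : ℕ) (k l : ℤ) : FreeGroup (ZMod n) :=
  FreeGroup.of 0 * FreeGroup.of (k : ZMod n) * FreeGroup.of (l : ZMod n)

/-- Condition (A): `n ≡ 0` and `k + l ≡ 0` modulo `3`. -/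
def CondA (n : ℕ) (k l : ℤ) : Prop :=
  (n : ℤ) ≡ 0 [ZMOD 3] ∧ k + l ≡ 0 [ZMOD 3]

/-- Condition (C): `3l ≡ 0` or `3k ≡ 0` or `3(l - k) ≡ 0` modulo `n`. -/
def CondC (n : ℕ) (k l : ℤ) : Prop :=
  3 * l ≡ 0 [ZMOD n] ∨ 3 * k ≡ 0 [ZMOD n] ∨ 3 * (l - k) ≡ 0 [ZMOD n]

/-- The relators of `⟨a, b | a^M = 1, b a b⁻¹ = a^R, b^N = a^(lam * M / (M, R - 1))⟩`,
with `a = of 0` and `b = of 1`. -/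
def metacyclicRelators (M N R lam : ℤ) : Set (FreeGroup (Fin 2)) :=
  let a : FreeGroup (Fin 2) := FreeGroup.of 0
  let b : FreeGroup (Fin 2) := FreeGroup.of 1
  {a ^ M, b * a * b⁻¹ * (a ^ R)⁻¹, b ^ N * (a ^ (lam * (M / (Int.gcd M (R - 1) : ℤ))))⁻¹}

/-- The metacyclic group `B(M, N, R, lam)`. -/
abbrev B (M N R lam : ℤ) : Type :=
  PresentedGroup (metacyclicRelators M N R lam)

/-- The finite cyclic group of order `m` (for `m > 0`), written multiplicatively. -/
abbrev Cyc (m : ℕ) : Type := Multiplicative (ZMod m)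

end CyclicPres

/-!
Rotating the relators cyclically replaces `(k, l)` by `(l - k, -k)`, so by (C) one may assume
`3k ≡ 0`. Put `s = k + l` and arrange the generators as `X(j, r) = x_{js + rk}`, with `r` modulo
`3`. The relations then read `X(j, r) X(j, r+1) X(j+1, r+2) = 1`, so the row `c_r = X(0, r)`
determines the others: with `w_r = c_r c_{r+1} c_{r+2}`, one finds `X(j, r) = w_r ^ e_j c_r`, where
`e_{j+1} = -2 e_j - 1`, that is, `3 e_j + 1 = (-2) ^ j`. Hence the group is generated by
`c_0, c_1, c_2`, subject only to `X(j, r) = X(j', r')` whenever `js + rk = j's + r'k` modulo `n`.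

* If `k ≡ 0`, this says that `c_0 = c_1 = c_2 = c` and `c ^ (3 e_n) = 1`.
* If (A) holds and `n = 3m`, it says that `w_0 ^ e_m = 1`, which leaves `c_0` and `c_1` free.
* Otherwise `s` is a unit and `k = ±ms` with `n = 3m`, the sign being changed by inverting the
  generators. For `k = ms` it says that `X(j, r)` depends only on `j + mr` modulo `n`; this makes
  `c_r = w_0 ^ e_{mr} c_0`, and the defining relations of the metacyclic group hold for
  `a = w_0` and `b = c_0`.
-/

namespace CyclicPres

open Function

section TripleFamily

variable {n : ℕ} {Γ : Type*} [Group Γ]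

/-- A solution in `Γ` of the defining relations of `G_n(x_0 x_k x_l)`; such families are the
homomorphisms from that group to `Γ`, see `liftFamily`. -/
def IsTripleFamily (k l : ZMod n) (x : ZMod n → Γ) : Prop :=
  ∀ i, x i * x (i + k) * x (i + l) = 1

theorem isTripleFamily_rotate {k l : ZMod n} {x : ZMod n → Γ} :
    IsTripleFamily (l - k) (-k) x ↔ IsTripleFamily k l x := by
  rw [IsTripleFamily, ← (Equiv.addRight k).forall_congr_right]
  refine forall_congr' fun i => ?_
  have hl : i + k + (l - k) = i + l := by abel
  rw [Equiv.coe_addRight, hl, add_neg_cancel_right, mul_eq_one_comm, ← mul_assoc]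

theorem isTripleFamily_inv {k l : ZMod n} {x : ZMod n → Γ} :
    IsTripleFamily (-k) (l - k) x⁻¹ ↔ IsTripleFamily k l x := by
  rw [IsTripleFamily, ← (Equiv.addRight k).forall_congr_right]
  refine forall_congr' fun i => ?_
  have hl : i + k + (l - k) = i + l := by abel
  simp only [Equiv.coe_addRight, hl, add_neg_cancel_right, Pi.inv_apply]
  rw [← mul_inv_rev, mul_inv_eq_one, inv_eq_iff_mul_eq_one]

theorem shift_iterate_word (k l : ℤ) (i : ℕ) :
    (shift n)^[i] (word n k l) =
      FreeGroup.of (i : ZMod n) * FreeGroup.of (i + k : ZMod n) *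
        FreeGroup.of (i + l : ZMod n) := by
  induction i with
  | zero => simp [word]
  | succ i ih =>
    rw [iterate_succ_apply', ih]
    simp only [shift, map_mul, FreeGroup.map.of, Nat.cast_succ, add_right_comm]

/-- The generator `x_i` of `G_n(x_0 x_k x_l)`. -/
def gen (n : ℕ) (k l : ℤ) (i : ZMod n) : CyclicGroup n (word n k l) :=
  PresentedGroup.of i

theorem isTripleFamily_gen [NeZero n] (k l : ℤ) :
    IsTripleFamily (k : ZMod n) (l : ZMod n) (gen n k l) := fun i => by
  have h : PresentedGroup.mk (relators n (word n k l)) ((shift n)^[i.val] (word n k l)) = 1 :=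
    PresentedGroup.one_of_mem ⟨i.val, i.val_lt, rfl⟩
  rwa [shift_iterate_word, ZMod.natCast_zmod_val, map_mul, map_mul] at h

/-- The homomorphism out of `G_n(x_0 x_k x_l)` that sends the generators to a given solution of
the defining relations. -/
def liftFamily {k l : ℤ} {x : ZMod n → Γ} (hx : IsTripleFamily (k : ZMod n) (l : ZMod n) x) :
    CyclicGroup n (word n k l) →* Γ :=
  PresentedGroup.toGroup (f := x) (by
    rintro r ⟨i, -, rfl⟩
    simpa only [shift_iterate_word, map_mul, FreeGroup.lift_apply_of] using hx i)

@[simp]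
theorem liftFamily_gen {k l : ℤ} {x : ZMod n → Γ}
    (hx : IsTripleFamily (k : ZMod n) (l : ZMod n) x) (i : ZMod n) :
    liftFamily hx (gen n k l i) = x i :=
  PresentedGroup.toGroup.of _

theorem hom_ext {k l : ℤ} {f g : CyclicGroup n (word n k l) →* Γ}
    (h : ∀ i, f (gen n k l i) = g (gen n k l i)) : f = g :=
  PresentedGroup.ext h

theorem nonempty_mulEquiv_rotate [NeZero n] (k l : ℤ) :
    Nonempty (CyclicGroup n (word n k l) ≃* CyclicGroup n (word n (l - k) (-k))) := by
  have hto : IsTripleFamily (k : ZMod n) (l : ZMod n) (gen n (l - k) (-k)) := by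
    simpa [isTripleFamily_rotate] using isTripleFamily_gen (n := n) (l - k) (-k)
  have hinv : IsTripleFamily ((l - k : ℤ) : ZMod n) ((-k : ℤ) : ZMod n) (gen n k l) := by
    simpa [isTripleFamily_rotate] using isTripleFamily_gen (n := n) k l
  exact ⟨(liftFamily hto).toMulEquiv (liftFamily hinv) (hom_ext fun i => by simp)
    (hom_ext fun i => by simp)⟩

theorem nonempty_mulEquiv_inv [NeZero n] (k l : ℤ) :
    Nonempty (CyclicGroup n (word n k l) ≃* CyclicGroup n (word n (-k) (l - k))) := by
  have hto : IsTripleFamily (k : ZMod n) (l : ZMod n) (gen n (-k) (l - k))⁻¹ := by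
    rw [← isTripleFamily_inv, inv_inv]
    simpa using isTripleFamily_gen (n := n) (-k) (l - k)
  have hinv : IsTripleFamily ((-k : ℤ) : ZMod n) ((l - k : ℤ) : ZMod n) (gen n k l)⁻¹ := by
    simpa [isTripleFamily_inv] using isTripleFamily_gen (n := n) k l
  exact ⟨(liftFamily hto).toMulEquiv (liftFamily hinv) (hom_ext fun i => by simp)
    (hom_ext fun i => by simp)⟩

end TripleFamily

/-- The Jacobsthal numbers with alternating signs, `((-2) ^ j - 1) / 3`: the exponents that occur
when the relations `x_i x_{i+k} x_{i+l} = 1` are solved recursively. -/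
def signedJacobsthal : ℕ → ℤ
  | 0 => 0
  | j + 1 => -2 * signedJacobsthal j - 1

local notation "J" => signedJacobsthal

@[simp]
theorem signedJacobsthal_zero : J 0 = 0 := rfl

theorem signedJacobsthal_succ (j : ℕ) : J (j + 1) = -2 * J j - 1 := rfl

theorem three_mul_signedJacobsthal_add_one (j : ℕ) : 3 * J j + 1 = (-2) ^ j := by
  induction j with
  | zero => rfl
  | succ j ih => rw [signedJacobsthal_succ, pow_succ, ← ih]; ring

theorem signedJacobsthal_add (i j : ℕ) : J (i + j) = J i + (-2) ^ i * J j := by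
  refine mul_left_cancel₀ (three_ne_zero' ℤ) ?_
  have hij := three_mul_signedJacobsthal_add_one (i + j)
  rw [pow_add, ← three_mul_signedJacobsthal_add_one j] at hij
  linear_combination hij - three_mul_signedJacobsthal_add_one i

theorem signedJacobsthal_dvd_mul (m q : ℕ) : J m ∣ J (m * q) := by
  induction q with
  | zero => simp
  | succ q ih => rw [Nat.mul_succ, signedJacobsthal_add]; exact ih.add (dvd_mul_left _ _)

theorem signedJacobsthal_modEq {m i j : ℕ} (h : i ≡ j [MOD m]) : J i ≡ J j [ZMOD J m] := by
  wlog hij : i ≤ j generalizing i j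
  · exact (this h.symm (le_of_not_ge hij)).symm
  obtain ⟨q, hq⟩ := (Nat.modEq_iff_dvd' hij).1 h
  obtain rfl : j = i + m * q := by omega
  rw [Int.modEq_iff_dvd, signedJacobsthal_add, add_sub_cancel_left]
  exact (signedJacobsthal_dvd_mul m q).mul_left _

theorem two_pow_sub_neg_one_pow (j : ℕ) : (2 ^ j - (-1) ^ j : ℤ) = |3 * J j| := by
  have hnonneg : (0 : ℤ) ≤ 2 ^ j - (-1) ^ j :=
    sub_nonneg.2 ((abs_le.1 (abs_neg_one_pow j).le).2.trans (one_le_pow₀ one_le_two))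
  have hsign : 3 * J j = (-1) ^ j * (2 ^ j - (-1) ^ j) := by
    rw [eq_sub_of_add_eq (three_mul_signedJacobsthal_add_one j), mul_sub, ← mul_pow, ← mul_pow]
    norm_num
  rw [hsign, abs_mul, abs_neg_one_pow, one_mul, abs_of_nonneg hnonneg]

theorem two_pow_sub_neg_one_pow_div_three (j : ℕ) : (2 ^ j - (-1) ^ j : ℤ) / 3 = |J j| := by
  rw [two_pow_sub_neg_one_pow, abs_mul, abs_of_pos three_pos,
    Int.mul_ediv_cancel_left _ three_ne_zero]

/-- The number `(p ^ 2 + p + 1) / 3` for `p = (-2) ^ m`, in terms of `(p - 1) / 3`. It is the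
exponent of `a` in the relation `b ^ 3 = a ^ (M / gcd (M, R - 1))` of the metacyclic group. -/
def cubeExponent (m : ℕ) : ℤ := 3 * J m ^ 2 + 3 * J m + 1

theorem signedJacobsthal_two_mul (m : ℕ) : J (2 * m) = J m * (3 * J m + 2) := by
  rw [two_mul, signedJacobsthal_add, ← three_mul_signedJacobsthal_add_one]
  ring

theorem signedJacobsthal_three_mul (m : ℕ) : J (3 * m) = 3 * J m * cubeExponent m := by
  rw [show 3 * m = m + 2 * m by ring, signedJacobsthal_add, signedJacobsthal_two_mul,
    ← three_mul_signedJacobsthal_add_one, cubeExponent]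
  ring

theorem signedJacobsthal_ne_zero {m : ℕ} (hm : m ≠ 0) : J m ≠ 0 := fun h => by
  have hpow := three_mul_signedJacobsthal_add_one m
  rw [h, mul_zero, zero_add, eq_comm] at hpow
  simpa [hm] using congrArg Int.natAbs hpow

theorem cubeExponent_pos (m : ℕ) : 0 < cubeExponent m := by
  rw [cubeExponent]
  nlinarith [sq_nonneg (2 * J m + 1)]

theorem abs_signedJacobsthal_div_gcd {m : ℕ} (hm : m ≠ 0) :
    |J (3 * m)| / (Int.gcd |J (3 * m)| ((-2) ^ (2 * m) - 1) : ℤ) = cubeExponent m := by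
  have hcop : Int.gcd (cubeExponent m) (3 * J m + 2) = 1 :=
    Int.isCoprime_iff_gcd_eq_one.1 ⟨3, -(3 * J m + 1), by rw [cubeExponent]; ring⟩
  have hgcd : (Int.gcd |J (3 * m)| ((-2) ^ (2 * m) - 1) : ℤ) = |3 * J m| := by
    rw [← three_mul_signedJacobsthal_add_one, add_sub_cancel_right, signedJacobsthal_two_mul,
      signedJacobsthal_three_mul, Int.abs_eq_natAbs, Int.gcd, Int.natAbs_natCast, ← Int.gcd,
      ← mul_assoc, Int.gcd_mul_left, hcop, mul_one, Int.abs_eq_natAbs]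
  have hne : |3 * J m| ≠ 0 := by simp [signedJacobsthal_ne_zero hm]
  rw [hgcd, signedJacobsthal_three_mul, abs_mul, abs_of_pos (cubeExponent_pos m),
    Int.mul_ediv_cancel_left _ hne]

section Propagation

variable {Γ : Type*} [Group Γ] {c : ℕ → Γ}

theorem zpow_eq_zpow_of_modEq {g : Γ} {e a b : ℤ} (hg : g ^ e = 1) (h : a ≡ b [ZMOD e]) :
    g ^ a = g ^ b :=
  zpow_eq_zpow_iff_modEq.2 (h.of_dvd (orderOf_dvd_iff_zpow_eq_one.2 hg))

/-- The product of three consecutive entries of a row. -/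
def rowTriple (c : ℕ → Γ) (r : ℕ) : Γ :=
  c r * c (r + 1) * c (r + 2)

/-- The array `X` with `X 0 = c` that solves `X j r * X j (r + 1) * X (j + 1) (r + 2) = 1`, when `c`
has period `3`. -/
def propagate (c : ℕ → Γ) (j r : ℕ) : Γ :=
  rowTriple c r ^ J j * c r

@[simp]
theorem propagate_zero (c : ℕ → Γ) (r : ℕ) : propagate c 0 r = c r := by
  simp [propagate]

theorem map_rowTriple {Δ : Type*} [Group Δ] (f : Γ →* Δ) (c : ℕ → Γ) (r : ℕ) :
    f (rowTriple c r) = rowTriple (fun r => f (c r)) r := by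
  simp [rowTriple]

theorem map_propagate {Δ : Type*} [Group Δ] (f : Γ →* Δ) (c : ℕ → Γ) (j r : ℕ) :
    f (propagate c j r) = propagate (fun r => f (c r)) j r := by
  simp [propagate, map_rowTriple]

theorem semiconjBy_rowTriple_succ (hc : Periodic c 3) (r : ℕ) :
    SemiconjBy (c r) (rowTriple c (r + 1)) (rowTriple c r) := by
  simp only [SemiconjBy, rowTriple, add_assoc, Nat.reduceAdd, hc r, mul_assoc]

theorem periodic_propagate (hc : Periodic c 3) (j : ℕ) : Periodic (propagate c j) 3 := fun r => by
  simp only [propagate, rowTriple, add_right_comm r 3, hc _]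

theorem propagate_mul_mul (hc : Periodic c 3) (i j k r : ℕ) :
    propagate c i r * propagate c j (r + 1) * propagate c k (r + 2) =
      rowTriple c r ^ (J i + J j + J k + 1) := by
  have h₁ := semiconjBy_rowTriple_succ hc r
  have h₂ := h₁.mul_left (semiconjBy_rowTriple_succ hc (r + 1))
  calc propagate c i r * propagate c j (r + 1) * propagate c k (r + 2)
      = rowTriple c r ^ J i * (c r * rowTriple c (r + 1) ^ J j) * c (r + 1) *
          (rowTriple c (r + 2) ^ J k * c (r + 2)) := by simp only [propagate, mul_assoc]
    _ = rowTriple c r ^ J i * rowTriple c r ^ J j *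
          (c r * c (r + 1) * rowTriple c (r + 2) ^ J k) * c (r + 2) := by
        rw [h₁.zpow_right]; simp only [mul_assoc]
    _ = rowTriple c r ^ J i * rowTriple c r ^ J j * rowTriple c r ^ J k * rowTriple c r := by
        rw [h₂.zpow_right, rowTriple]; simp only [mul_assoc]
    _ = rowTriple c r ^ (J i + J j + J k + 1) := by simp only [zpow_add, zpow_one]

theorem propagate_relation (hc : Periodic c 3) (j r : ℕ) :
    propagate c j r * propagate c j (r + 1) * propagate c (j + 1) (r + 2) = 1 := by
  rw [propagate_mul_mul hc, signedJacobsthal_succ,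
    show J j + J j + (-2 * J j - 1) + 1 = 0 by ring, zpow_zero]

theorem rowTriple_propagate (hc : Periodic c 3) (j r : ℕ) :
    rowTriple (propagate c j) r = rowTriple c r ^ ((-2 : ℤ) ^ j) := by
  rw [rowTriple, propagate_mul_mul hc, ← three_mul_signedJacobsthal_add_one]
  ring_nf

theorem eq_propagate {X : ℕ → ℕ → Γ} (hper : ∀ j, Periodic (X j) 3)
    (hX : ∀ j r, X j r * X j (r + 1) * X (j + 1) (r + 2) = 1) (j r : ℕ) :
    X j r = propagate (X 0) j r := by
  induction j generalizing r with
  | zero => rw [propagate_zero]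
  | succ j ih =>
    have hrel := propagate_relation (hper 0) j (r + 1)
    rw [← ih, ← ih, ← hX j (r + 1), mul_right_inj] at hrel
    rw [← hper (j + 1) r, ← periodic_propagate (hper 0) (j + 1) r]
    exact hrel.symm

end Propagation

section InitialRow

variable {n : ℕ} {Γ : Type*} [Group Γ]

/-- The subscript `j (k + l) + r k` of the generator in row `j` and column `r`, when the generators
`x_i` are arranged so that the relations become `X j r * X j (r + 1) * X (j + 1) (r + 2) = 1`. -/
def subscript (k l : ZMod n) (j r : ℕ) : ZMod n :=
  j * (k + l) + r * k

theorem subscript_add_left (k l : ZMod n) (j r : ℕ) :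
    subscript k l j r + k = subscript k l j (r + 1) := by
  simp only [subscript]; push_cast; ring

theorem subscript_add_right {k l : ZMod n} (h3 : 3 * k = 0) (j r : ℕ) :
    subscript k l j r + l = subscript k l (j + 1) (r + 2) := by
  simp only [subscript]; push_cast; linear_combination -h3

theorem periodic_subscript {k : ZMod n} (h3 : 3 * k = 0) (l : ZMod n) (j : ℕ) :
    Periodic (subscript k l j) 3 := fun r => by
  simp only [subscript]; push_cast; linear_combination h3

theorem exists_subscript_eq [NeZero n] {k l : ZMod n} (hkl : IsCoprime k l) (i : ZMod n) :
    ∃ j r, subscript k l j r = i := by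
  obtain ⟨u, v, huv⟩ := hkl
  refine ⟨(i * v).val, (i * (u - v)).val, ?_⟩
  simp only [subscript, ZMod.natCast_zmod_val]
  linear_combination i * huv

/-- The array generated by the row `c` has equal entries at positions with the same subscript, so
that it is a family of elements indexed by `ZMod n`. -/
def IsInitialRow (k l : ZMod n) (c : ℕ → Γ) : Prop :=
  ∀ ⦃j r j' r'⦄, subscript k l j r = subscript k l j' r' → propagate c j r = propagate c j' r'

theorem IsInitialRow.periodic {k l : ZMod n} {c : ℕ → Γ} (hc : IsInitialRow k l c)
    (h3 : 3 * k = 0) : Periodic c 3 := fun r => by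
  simpa using hc (periodic_subscript h3 l 0 r)

theorem IsTripleFamily.apply_subscript {k l : ZMod n} {x : ZMod n → Γ}
    (hx : IsTripleFamily k l x) (h3 : 3 * k = 0) (j r : ℕ) :
    x (subscript k l j r) = propagate (fun r => x (subscript k l 0 r)) j r :=
  eq_propagate (X := fun j r => x (subscript k l j r))
    (fun j r => congrArg x (periodic_subscript h3 l j r))
    (fun j r => by
      rw [← subscript_add_left, ← subscript_add_right h3]; exact hx _) j r

theorem IsTripleFamily.isInitialRow {k l : ZMod n} {x : ZMod n → Γ}
    (hx : IsTripleFamily k l x) (h3 : 3 * k = 0) :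
    IsInitialRow k l fun r => x (subscript k l 0 r) := fun j r j' r' h => by
  rw [← hx.apply_subscript h3, ← hx.apply_subscript h3, h]

theorem IsInitialRow.exists_isTripleFamily [NeZero n] {k l : ZMod n} {c : ℕ → Γ}
    (hc : IsInitialRow k l c) (hkl : IsCoprime k l) (h3 : 3 * k = 0) :
    ∃ x, IsTripleFamily k l x ∧ ∀ j r, x (subscript k l j r) = propagate c j r := by
  have hfactors : (uncurry (propagate c)).FactorsThrough (uncurry (subscript k l)) :=
    fun _ _ h => hc h
  have hx (j r : ℕ) : extend (uncurry (subscript k l)) (uncurry (propagate c)) 1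
      (subscript k l j r) = propagate c j r := hfactors.extend_apply 1 (j, r)
  refine ⟨_, fun i => ?_, hx⟩
  obtain ⟨j, r, rfl⟩ := exists_subscript_eq hkl i
  rw [subscript_add_left, subscript_add_right h3, hx, hx, hx]
  exact propagate_relation (hc.periodic h3) j r

theorem nonempty_mulEquiv_of_isInitialRow [NeZero n] {k l : ℤ}
    (hkl : IsCoprime (k : ZMod n) (l : ZMod n)) (h3 : 3 * (k : ZMod n) = 0) {c : ℕ → Γ}
    (hc : IsInitialRow (k : ZMod n) (l : ZMod n) c) (φ : Γ →* CyclicGroup n (word n k l))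
    (hφ : ∀ r, φ (c r) = gen n k l (subscript (k : ZMod n) (l : ZMod n) 0 r))
    (hext : ∀ f : Γ →* Γ, (∀ r, f (c r) = c r) → f = MonoidHom.id Γ) :
    Nonempty (CyclicGroup n (word n k l) ≃* Γ) := by
  obtain ⟨x, hx, hxc⟩ := hc.exists_isTripleFamily hkl h3
  refine ⟨(liftFamily hx).toMulEquiv φ (hom_ext fun i => ?_) (hext _ fun r => ?_)⟩
  · obtain ⟨j, r, rfl⟩ := exists_subscript_eq hkl i
    rw [MonoidHom.comp_apply, liftFamily_gen, hxc, map_propagate, MonoidHom.id_apply,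
      (isTripleFamily_gen k l).apply_subscript h3]
    simp only [hφ]
  · rw [MonoidHom.comp_apply, hφ, liftFamily_gen, hxc, propagate_zero]

theorem IsInitialRow.rowTriple_zpow_eq_one {k l : ZMod n} {c : ℕ → Γ} (hc : IsInitialRow k l c)
    {m : ℕ} (hm : (m : ZMod n) * (k + l) = 0) : rowTriple c 0 ^ J m = 1 := by
  have h : propagate c m 0 = propagate c 0 0 := hc (by simp [subscript, hm])
  rwa [propagate_zero, propagate, mul_eq_right] at h

end InitialRow

section Cyclic

variable {N : ℕ} {Γ : Type*} [Group Γ]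

/-- The homomorphism out of a cyclic group that sends the generator to `g`. -/
def cycLift {g : Γ} (hg : g ^ N = 1) : Cyc N →* Γ :=
  AddMonoidHom.toMultiplicativeLeft
    (ZMod.lift N ⟨zmultiplesHom _ (Additive.ofMul g), by simp [← ofMul_pow, hg]⟩)

@[simp]
theorem cycLift_ofAdd_one {g : Γ} (hg : g ^ N = 1) :
    cycLift hg (Multiplicative.ofAdd 1) = g := by
  have h := ZMod.lift_coe N (A := Additive Γ)
    ⟨zmultiplesHom _ (Additive.ofMul g), by simp [← ofMul_pow, hg]⟩ 1
  rw [Int.cast_one] at h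
  exact congrArg Additive.toMul (h.trans (one_zsmul _))

theorem ofAdd_one_pow_eq_one : (Multiplicative.ofAdd 1 : Cyc N) ^ N = 1 := by
  simp [← ofAdd_nsmul]

theorem cyc_hom_ext {f g : Cyc N →* Γ}
    (h : f (Multiplicative.ofAdd 1) = g (Multiplicative.ofAdd 1)) : f = g := by
  refine MonoidHom.ext fun z => ?_
  obtain ⟨z, rfl⟩ := Multiplicative.ofAdd.surjective z
  obtain ⟨z, rfl⟩ := ZMod.intCast_surjective z
  rw [← zsmul_one, ofAdd_zsmul, map_zpow, map_zpow, h]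

variable {n : ℕ} {k l : ZMod n}

theorem rowTriple_const (g : Γ) (r : ℕ) : rowTriple (fun _ => g) r = g ^ 3 := by
  simp [rowTriple, pow_succ]

theorem propagate_const (g : Γ) (j r : ℕ) :
    propagate (fun _ => g) j r = g ^ ((-2 : ℤ) ^ j) := by
  rw [propagate, rowTriple_const, ← three_mul_signedJacobsthal_add_one, zpow_add_one, zpow_mul,
    zpow_ofNat]

theorem isInitialRow_const_iff (hl : IsUnit l) {g : Γ} :
    IsInitialRow 0 l (fun _ => g) ↔ g ^ (3 * J n) = 1 := by
  constructor
  · intro hc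
    rw [zpow_mul, zpow_ofNat, ← rowTriple_const g 0]
    exact hc.rowTriple_zpow_eq_one (by simp)
  · intro hg j r j' r' h
    have hj : j ≡ j' [MOD n] := by
      simpa [subscript, hl.mul_left_inj, ZMod.natCast_eq_natCast_iff] using h
    simp only [propagate_const, ← three_mul_signedJacobsthal_add_one]
    exact zpow_eq_zpow_of_modEq hg (((signedJacobsthal_modEq hj).mul_left').add_right 1)

theorem nonempty_mulEquiv_cyc_natAbs [NeZero n] {k l : ℤ}
    (hkl : IsCoprime (k : ZMod n) (l : ZMod n)) (hk : (k : ZMod n) = 0) :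
    Nonempty (CyclicGroup n (word n k l) ≃* Cyc (3 * J n).natAbs) := by
  have hl : IsUnit (l : ZMod n) := by rwa [hk, isCoprime_zero_left] at hkl
  have h3 : 3 * (k : ZMod n) = 0 := by rw [hk, mul_zero]
  have hgen : IsInitialRow (0 : ZMod n) (l : ZMod n) (fun _ => gen n k l 0) := by
    simpa [subscript, hk] using (isTripleFamily_gen k l).isInitialRow h3
  have hpow : gen n k l 0 ^ (3 * J n).natAbs = 1 :=
    pow_natAbs_eq_one.2 ((isInitialRow_const_iff hl).1 hgen)
  refine nonempty_mulEquiv_of_isInitialRow hkl h3 (c := fun _ => Multiplicative.ofAdd 1) ?_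
    (cycLift hpow) (fun r => ?_) (fun f hf => cyc_hom_ext (hf 0))
  · rw [hk, isInitialRow_const_iff hl]
    exact pow_natAbs_eq_one.1 ofAdd_one_pow_eq_one
  · simp [subscript, hk]

end Cyclic

section FreeProduct

variable {Γ : Type*} [Group Γ] {c : ℕ → Γ} {m : ℕ}

theorem three_mul_natCast_eq_zero : 3 * (m : ZMod (3 * m)) = 0 := by
  exact_mod_cast ZMod.natCast_self (3 * m)

theorem three_mul_intCast_eq_zero_iff {z : ℤ} : 3 * (z : ZMod (3 * m)) = 0 ↔ (m : ℤ) ∣ z := by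
  rw [← mul_dvd_mul_iff_left (three_ne_zero' ℤ)]
  exact_mod_cast ZMod.intCast_zmod_eq_zero_iff_dvd (3 * z) (3 * m)

theorem three_mul_eq_zero_of_eq_natCast_mul {t s : ZMod (3 * m)} (h : t = m * s) : 3 * t = 0 := by
  linear_combination 3 * h + s * three_mul_natCast_eq_zero (m := m)

theorem modEq_of_subscript_eq {k l : ℤ} (hkl : IsCoprime (k : ZMod (3 * m)) (l : ZMod (3 * m)))
    (h3 : 3 * (k : ZMod (3 * m)) = 0) (hA : k + l ≡ 0 [ZMOD 3]) {j r j' r' : ℕ}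
    (h : subscript (k : ZMod (3 * m)) (l : ZMod (3 * m)) j r = subscript k l j' r') :
    j ≡ j' [MOD m] ∧ r ≡ r' [MOD 3] := by
  rw [← ZMod.natCast_eq_natCast_iff, ← ZMod.natCast_eq_natCast_iff]
  constructor
  · have hk : (k : ZMod m) = 0 :=
      (ZMod.intCast_zmod_eq_zero_iff_dvd k m).2 (three_mul_intCast_eq_zero_iff.1 h3)
    have hl : IsUnit (l : ZMod m) := by
      simpa [hk, isCoprime_zero_left] using hkl.map (ZMod.castHom (dvd_mul_left m 3) (ZMod m))
    simpa [subscript, hk, hl.mul_left_inj] using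
      congrArg (ZMod.castHom (dvd_mul_left m 3) (ZMod m)) h
  · have hs : (k : ZMod 3) + l = 0 := by
      exact_mod_cast (ZMod.intCast_eq_intCast_iff (k + l) 0 3).2 hA
    have hk : IsUnit (k : ZMod 3) := by
      simpa [eq_neg_of_add_eq_zero_right hs] using
        hkl.map (ZMod.castHom (dvd_mul_right 3 m) (ZMod 3))
    simpa [subscript, hs, hk.mul_left_inj] using
      congrArg (ZMod.castHom (dvd_mul_right 3 m) (ZMod 3)) h

theorem rowTriple_zpow_eq_one (hc : Periodic c 3) {e : ℤ} (h : rowTriple c 0 ^ e = 1) (r : ℕ) :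
    rowTriple c r ^ e = 1 := by
  induction r with
  | zero => exact h
  | succ r ih => simpa [SemiconjBy, ih] using (semiconjBy_rowTriple_succ hc r).zpow_right e

theorem isInitialRow_of_rowTriple_zpow_eq_one {k l : ℤ}
    (hkl : IsCoprime (k : ZMod (3 * m)) (l : ZMod (3 * m))) (h3 : 3 * (k : ZMod (3 * m)) = 0)
    (hA : k + l ≡ 0 [ZMOD 3]) (hc : Periodic c 3) (hw : rowTriple c 0 ^ J m = 1) :
    IsInitialRow (k : ZMod (3 * m)) (l : ZMod (3 * m)) c := fun j r j' r' h => by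
  obtain ⟨hj, hr⟩ := modEq_of_subscript_eq hkl h3 hA h
  have hcol : propagate c j r = propagate c j r' := by
    rw [← (periodic_propagate hc j).map_mod_nat, hr, (periodic_propagate hc j).map_mod_nat]
  rw [hcol, propagate, propagate, zpow_eq_zpow_of_modEq (rowTriple_zpow_eq_one hc hw r')
    (signedJacobsthal_modEq hj)]

/-- The row of period `3` with first entries `a` and `b` in which three consecutive entries starting
at a multiple of `3` have the product `w`. -/
def freeRow (w a b : Γ) (r : ℕ) : Γ :=
  ![a, b, (a * b)⁻¹ * w] (Fin.ofNat 3 r)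

theorem periodic_freeRow (w a b : Γ) : Periodic (freeRow w a b) 3 := fun r => by
  simp [freeRow, Fin.ofNat]

theorem rowTriple_freeRow (w a b : Γ) : rowTriple (freeRow w a b) 0 = w :=
  mul_inv_cancel_left (a * b) w

theorem eq_freeRow (hc : Periodic c 3) : c = freeRow (rowTriple c 0) (c 0) (c 1) := by
  refine funext fun r => ?_
  rw [← hc.map_mod_nat, ← (periodic_freeRow _ _ _).map_mod_nat]
  have := Nat.mod_lt r three_pos
  interval_cases r % 3 <;> simp [freeRow, rowTriple, Fin.ofNat, mul_assoc]

theorem map_freeRow {Δ : Type*} [Group Δ] (f : Γ →* Δ) (w a b : Γ) (r : ℕ) :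
    f (freeRow w a b r) = freeRow (f w) (f a) (f b) r := by
  simp only [freeRow]
  generalize Fin.ofNat 3 r = i
  fin_cases i <;> simp

open Monoid (Coprod)

/-- The free product `Z_N * Z * Z`. -/
abbrev CycCoprod (N : ℕ) : Type :=
  Coprod (Coprod (Cyc N) (Multiplicative ℤ)) (Multiplicative ℤ)

/-- The row of generators `(b, b', (b b')⁻¹ a)` of `Z_N * Z * Z`, where `a`, `b` and `b'` generate
the factors. -/
def coprodRow (N : ℕ) : ℕ → CycCoprod N :=
  freeRow (Coprod.inl (Coprod.inl (Multiplicative.ofAdd 1)))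
    (Coprod.inl (Coprod.inr (Multiplicative.ofAdd 1))) (Coprod.inr (Multiplicative.ofAdd 1))

theorem rowTriple_coprodRow (N : ℕ) :
    rowTriple (coprodRow N) 0 = Coprod.inl (Coprod.inl (Multiplicative.ofAdd 1)) :=
  rowTriple_freeRow _ _ _

theorem rowTriple_coprodRow_pow (N : ℕ) : rowTriple (coprodRow N) 0 ^ N = 1 := by
  rw [rowTriple_coprodRow, ← map_pow, ← map_pow, ofAdd_one_pow_eq_one, map_one, map_one]

/-- The homomorphism out of `Z_N * Z * Z` that sends `coprodRow` to a given row of period `3`. -/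
def coprodLift {N : ℕ} (hw : rowTriple c 0 ^ N = 1) :
    CycCoprod N →* Γ :=
  Coprod.lift (Coprod.lift (cycLift hw) (zpowersHom _ (c 0))) (zpowersHom _ (c 1))

theorem coprodLift_coprodRow {N : ℕ} (hc : Periodic c 3) (hw : rowTriple c 0 ^ N = 1) (r : ℕ) :
    coprodLift hw (coprodRow N r) = c r := by
  refine (map_freeRow (Γ := CycCoprod N) (coprodLift hw) _ _ _ r).trans ?_
  simp [coprodLift, ← eq_freeRow hc]

theorem coprodRow_hom_ext {N : ℕ} {f g : CycCoprod N →* Γ}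
    (h : ∀ r, f (coprodRow N r) = g (coprodRow N r)) : f = g := by
  refine Coprod.hom_ext (Coprod.hom_ext (cyc_hom_ext ?_) (MonoidHom.ext_mint (h 0)))
    (MonoidHom.ext_mint (h 1))
  calc f (Coprod.inl (Coprod.inl (Multiplicative.ofAdd 1)))
      = rowTriple (fun r => f (coprodRow N r)) 0 := by
        rw [← rowTriple_coprodRow]; exact map_rowTriple (Γ := CycCoprod N) f _ _
    _ = rowTriple (fun r => g (coprodRow N r)) 0 := by rw [funext h]
    _ = g (Coprod.inl (Coprod.inl (Multiplicative.ofAdd 1))) := by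
        rw [← rowTriple_coprodRow]; exact (map_rowTriple (Γ := CycCoprod N) g _ _).symm

theorem nonempty_mulEquiv_cycCoprod_natAbs [NeZero m] {k l : ℤ}
    (hkl : IsCoprime (k : ZMod (3 * m)) (l : ZMod (3 * m))) (h3 : 3 * (k : ZMod (3 * m)) = 0)
    (hA : k + l ≡ 0 [ZMOD 3]) :
    Nonempty (CyclicGroup (3 * m) (word (3 * m) k l) ≃* CycCoprod (J m).natAbs) := by
  have hgen := (isTripleFamily_gen (n := 3 * m) k l).isInitialRow h3
  have hm : (m : ZMod (3 * m)) * (k + l) = 0 := by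
    obtain ⟨q, hq⟩ := Int.modEq_zero_iff_dvd.1 hA
    have hs : (k + l : ZMod (3 * m)) = 3 * q := mod_cast congrArg Int.cast hq
    linear_combination (m : ZMod (3 * m)) * hs + q * three_mul_natCast_eq_zero (m := m)
  have hpow := pow_natAbs_eq_one.2 (hgen.rowTriple_zpow_eq_one hm)
  refine nonempty_mulEquiv_of_isInitialRow hkl h3 (c := coprodRow (J m).natAbs)
    (isInitialRow_of_rowTriple_zpow_eq_one hkl h3 hA (periodic_freeRow _ _ _) ?_)
    (coprodLift hpow) (coprodLift_coprodRow (hgen.periodic h3) hpow) (fun f hf => ?_)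
  · exact pow_natAbs_eq_one.1 (rowTriple_coprodRow_pow _)
  · exact coprodRow_hom_ext hf

end FreeProduct

section Metacyclic

variable {Γ : Type*} [Group Γ] {M N R lam : ℤ}

namespace B

/-- The generator `a` of `B(M, N, R, lam)`. -/
def a : B M N R lam :=
  PresentedGroup.of 0

/-- The generator `b` of `B(M, N, R, lam)`. -/
def b : B M N R lam :=
  PresentedGroup.of 1

theorem a_zpow : (a : B M N R lam) ^ M = 1 :=
  PresentedGroup.one_of_mem (rels := metacyclicRelators M N R lam) (Or.inl rfl)

theorem semiconjBy_b_a : SemiconjBy (b : B M N R lam) a (a ^ R) := by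
  have h : b * a * b⁻¹ * (a ^ R)⁻¹ = (1 : B M N R lam) :=
    PresentedGroup.one_of_mem (rels := metacyclicRelators M N R lam) (Or.inr (Or.inl rfl))
  rwa [mul_inv_eq_one, mul_inv_eq_iff_eq_mul] at h

theorem b_zpow : (b : B M N R lam) ^ N = a ^ (lam * (M / (Int.gcd M (R - 1) : ℤ))) :=
  mul_inv_eq_one.1 <|
    PresentedGroup.one_of_mem (rels := metacyclicRelators M N R lam) (Or.inr (Or.inr rfl))

/-- The homomorphism out of `B(M, N, R, lam)` that sends `a` and `b` to elements satisfying the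
defining relations. -/
def lift {u v : Γ} (hu : u ^ M = 1) (huv : SemiconjBy v u (u ^ R))
    (hv : v ^ N = u ^ (lam * (M / (Int.gcd M (R - 1) : ℤ)))) : B M N R lam →* Γ :=
  PresentedGroup.toGroup (f := ![u, v]) (by
    rintro r (rfl | rfl | rfl)
    · simpa using hu
    · simpa [mul_inv_eq_one, mul_inv_eq_iff_eq_mul] using huv.eq
    · simpa [mul_inv_eq_one] using hv)

@[simp]
theorem lift_a {u v : Γ} (hu : u ^ M = 1) (huv : SemiconjBy v u (u ^ R))
    (hv : v ^ N = u ^ (lam * (M / (Int.gcd M (R - 1) : ℤ)))) : lift hu huv hv a = u :=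
  PresentedGroup.toGroup.of _

@[simp]
theorem lift_b {u v : Γ} (hu : u ^ M = 1) (huv : SemiconjBy v u (u ^ R))
    (hv : v ^ N = u ^ (lam * (M / (Int.gcd M (R - 1) : ℤ)))) : lift hu huv hv b = v :=
  PresentedGroup.toGroup.of _

theorem hom_ext {f g : B M N R lam →* Γ} (ha : f a = g a) (hb : f b = g b) : f = g :=
  PresentedGroup.ext (Fin.forall_fin_two.2 ⟨ha, hb⟩)

end B

/-- The solution of the defining relations in the metacyclic group on `a` and `b`, see
`isInitialRow_metacyclicRow`. -/
def metacyclicRow (a b : Γ) (m r : ℕ) : Γ :=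
  a ^ J (m * r) * b

variable {a b : Γ} {m : ℕ}

theorem map_metacyclicRow {Δ : Type*} [Group Δ] (f : Γ →* Δ) (a b : Γ) (m r : ℕ) :
    f (metacyclicRow a b m r) = metacyclicRow (f a) (f b) m r := by
  simp [metacyclicRow]

theorem rowTriple_metacyclicRow (ha : a ^ J (3 * m) = 1)
    (hab : SemiconjBy b a (a ^ ((-2 : ℤ) ^ (2 * m)))) (r : ℕ) :
    rowTriple (metacyclicRow a b m) r = a ^ ((-2 : ℤ) ^ (m * r) - cubeExponent m) * b ^ 3 := by
  have hconj (i : ℤ) : b * a ^ i = a ^ ((-2 : ℤ) ^ (2 * m) * i) * b := by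
    rw [zpow_mul]; exact hab.zpow_right i
  have hexp : J (m * r) + (-2) ^ (2 * m) * (J (m * (r + 1)) + (-2) ^ (2 * m) * J (m * (r + 2)))
      ≡ (-2) ^ (m * r) - cubeExponent m [ZMOD J (3 * m)] := by
    rw [Int.modEq_iff_dvd, signedJacobsthal_three_mul, mul_add m r 1, mul_add m r 2, mul_one,
      mul_comm m 2, add_comm (m * r), add_comm (m * r), signedJacobsthal_add m,
      signedJacobsthal_add (2 * m), signedJacobsthal_two_mul, two_mul m, pow_add (-2 : ℤ) m m,
      ← three_mul_signedJacobsthal_add_one m, ← three_mul_signedJacobsthal_add_one (m * r),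
      cubeExponent]
    -- The quotient by `J (3 * m) = (P ^ 3 - 1) / 3`, where `P = 3 * J m + 1`.
    exact ⟨-3 * J (m * r) * ((3 * J m + 1) ^ 3 + 2) - ((3 * J m + 1) ^ 3 - 3 * J m + 1), by ring⟩
  calc rowTriple (metacyclicRow a b m) r
      = a ^ J (m * r) * (b * a ^ J (m * (r + 1))) * (b * a ^ J (m * (r + 2))) * b := by
        simp only [rowTriple, metacyclicRow, mul_assoc]
    _ = a ^ J (m * r) *
          (b * a ^ (J (m * (r + 1)) + (-2) ^ (2 * m) * J (m * (r + 2)))) * b ^ 2 := by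
        rw [hconj (J (m * (r + 2)))]; simp only [zpow_add, pow_two, mul_assoc]
    _ = a ^ (J (m * r) + (-2) ^ (2 * m) *
          (J (m * (r + 1)) + (-2) ^ (2 * m) * J (m * (r + 2)))) * b ^ 3 := by
        rw [hconj, zpow_add a (J (m * r)), pow_succ' b 2]; simp only [mul_assoc]
    _ = a ^ ((-2 : ℤ) ^ (m * r) - cubeExponent m) * b ^ 3 := by
        rw [zpow_eq_zpow_of_modEq ha hexp]

theorem rowTriple_metacyclicRow_zero (ha : a ^ J (3 * m) = 1)
    (hab : SemiconjBy b a (a ^ ((-2 : ℤ) ^ (2 * m)))) (hb : b ^ 3 = a ^ cubeExponent m) :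
    rowTriple (metacyclicRow a b m) 0 = a := by
  rw [rowTriple_metacyclicRow ha hab, hb, ← zpow_add, sub_add_cancel, mul_zero, pow_zero, zpow_one]

theorem isInitialRow_metacyclicRow {k l : ZMod (3 * m)} (hkl : IsUnit (k + l))
    (hk : k = m * (k + l)) (ha : a ^ J (3 * m) = 1)
    (hab : SemiconjBy b a (a ^ ((-2 : ℤ) ^ (2 * m)))) (hb : b ^ 3 = a ^ cubeExponent m) :
    IsInitialRow k l (metacyclicRow a b m) := fun j r j' r' h => by
  have hprop (j r : ℕ) : propagate (metacyclicRow a b m) j r = a ^ J (m * r + j) * b := by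
    rw [propagate, rowTriple_metacyclicRow ha hab, hb, ← zpow_add, sub_add_cancel, metacyclicRow,
      signedJacobsthal_add, ← zpow_mul, ← mul_assoc, ← zpow_add, add_comm]
  have hsub (j r : ℕ) : subscript k l j r = (m * r + j : ℕ) * (k + l) := by
    simp only [subscript]; push_cast; linear_combination (r : ZMod (3 * m)) * hk
  rw [hsub, hsub, hkl.mul_left_inj, ZMod.natCast_eq_natCast_iff] at h
  rw [hprop, hprop, zpow_eq_zpow_of_modEq ha (signedJacobsthal_modEq h)]

namespace IsInitialRow

variable {k l : ZMod (3 * m)} {c : ℕ → Γ}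

theorem rowTriple_zpow_three_mul_eq_one (hc : IsInitialRow k l c) :
    rowTriple c 0 ^ J (3 * m) = 1 :=
  hc.rowTriple_zpow_eq_one (by rw [ZMod.natCast_self, zero_mul])

theorem propagate_mul_eq (hc : IsInitialRow k l c) (hk : k = m * (k + l)) (r q : ℕ) :
    propagate c (m * q) r = c (r + q) := by
  rw [← propagate_zero c (r + q)]
  refine hc ?_
  simp only [subscript]; push_cast; linear_combination -(q : ZMod (3 * m)) * hk

theorem eq_metacyclicRow (hc : IsInitialRow k l c) (hk : k = m * (k + l)) :
    c = metacyclicRow (rowTriple c 0) (c 0) m := funext fun r => by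
  rw [← zero_add r, ← hc.propagate_mul_eq hk, zero_add, propagate, metacyclicRow]

theorem semiconjBy_rowTriple (hc : IsInitialRow k l c) (hk : k = m * (k + l)) :
    SemiconjBy (c 0) (rowTriple c 0) (rowTriple c 0 ^ ((-2 : ℤ) ^ (2 * m))) := by
  have hper := hc.periodic (three_mul_eq_zero_of_eq_natCast_mul hk)
  have htwo : rowTriple c 2 = rowTriple c 0 ^ ((-2 : ℤ) ^ (2 * m)) := by
    rw [mul_comm 2 m, ← rowTriple_propagate hper]
    simp only [rowTriple, hc.propagate_mul_eq hk, zero_add, add_comm]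
  have hthree : rowTriple c 3 = rowTriple c 0 := by
    simp only [rowTriple, hper _]
  have hc₂ : c 0 = rowTriple c 0 ^ (-J (m * 2)) * c 2 := by
    rw [zpow_neg, eq_inv_mul_iff_mul_eq]
    exact hc.propagate_mul_eq hk 0 2
  have hsemi : SemiconjBy (c 2) (rowTriple c 0) (rowTriple c 0 ^ ((-2 : ℤ) ^ (2 * m))) := by
    simpa only [htwo, hthree] using semiconjBy_rowTriple_succ hper 2
  nth_rw 1 [hc₂]
  exact SemiconjBy.mul_left (Commute.zpow_zpow_self _ _ _) hsemi

theorem apply_zero_pow_three (hc : IsInitialRow k l c) (hk : k = m * (k + l)) :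
    c 0 ^ 3 = rowTriple c 0 ^ cubeExponent m := by
  have h :=
    rowTriple_metacyclicRow hc.rowTriple_zpow_three_mul_eq_one (hc.semiconjBy_rowTriple hk) 0
  rwa [← hc.eq_metacyclicRow hk, mul_zero, pow_zero, zpow_sub, zpow_one, mul_assoc, left_eq_mul,
    inv_mul_eq_one, eq_comm] at h

end IsInitialRow

theorem nonempty_mulEquiv_B_of_eq_natCast_mul [NeZero m] {k l : ℤ}
    (hkl : IsUnit (k + l : ZMod (3 * m))) (hk : (k : ZMod (3 * m)) = m * (k + l)) :
    Nonempty (CyclicGroup (3 * m) (word (3 * m) k l) ≃*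
      B |J (3 * m)| 3 ((-2) ^ (2 * m)) 1) := by
  have h3 := three_mul_eq_zero_of_eq_natCast_mul hk
  have hcop : IsCoprime (k : ZMod (3 * m)) (l : ZMod (3 * m)) := by
    obtain ⟨u, hu⟩ := hkl.exists_left_inv
    exact ⟨u, u, by rw [← mul_add, hu]⟩
  have hgen := (isTripleFamily_gen (n := 3 * m) k l).isInitialRow h3
  have hb {Γ : Type} [Group Γ] {u v : Γ} : v ^ (3 : ℤ) = u ^ (1 * (|J (3 * m)| /
      (Int.gcd |J (3 * m)| ((-2) ^ (2 * m) - 1) : ℤ))) ↔ v ^ 3 = u ^ cubeExponent m := by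
    rw [one_mul, abs_signedJacobsthal_div_gcd (NeZero.ne m), zpow_ofNat]
  have ha : (B.a : B |J (3 * m)| 3 ((-2) ^ (2 * m)) 1) ^ J (3 * m) = 1 :=
    (zpow_abs_eq_one _ _).1 B.a_zpow
  refine nonempty_mulEquiv_of_isInitialRow hcop h3
    (isInitialRow_metacyclicRow hkl hk ha B.semiconjBy_b_a (hb.1 B.b_zpow))
    (B.lift ((zpow_abs_eq_one _ _).2 hgen.rowTriple_zpow_three_mul_eq_one)
      (hgen.semiconjBy_rowTriple hk) (hb.2 (hgen.apply_zero_pow_three hk))) (fun r => ?_)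
    (fun f hf => ?_)
  · rw [map_metacyclicRow, B.lift_a, B.lift_b, ← hgen.eq_metacyclicRow hk]
  · have hfb : f B.b = B.b := by simpa [metacyclicRow] using hf 0
    have hrow := rowTriple_metacyclicRow_zero ha B.semiconjBy_b_a (hb.1 B.b_zpow)
    refine B.hom_ext ?_ hfb
    rw [MonoidHom.id_apply, ← hrow, map_rowTriple]
    simp only [hf]

end Metacyclic

section Reduction

variable {n m : ℕ} {k l : ℤ}

theorem isUnit_add (hkl : IsCoprime (k : ZMod n) (l : ZMod n)) (h3 : 3 * (k : ZMod n) = 0)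
    (hs : ¬k + l ≡ 0 [ZMOD 3]) : IsUnit (k + l : ZMod n) := by
  have hcop : IsCoprime (k + l : ZMod n) 3 := by
    rw [Int.modEq_zero_iff_dvd, ← Int.prime_three.coprime_iff_not_dvd] at hs
    simpa using hs.symm.map (Int.castRingHom (ZMod n))
  obtain ⟨u, v, huv⟩ := hkl
  have hdvd : (k + l : ZMod n) ∣ 3 := ⟨3 * v, by linear_combination (u - v) * h3 - 3 * huv⟩
  exact hcop.isUnit_of_dvd' dvd_rfl hdvd

theorem eq_zero_or_eq_or_eq_neg_of_three_mul_eq_zero {t : ZMod (3 * m)} (ht : 3 * t = 0) :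
    t = 0 ∨ t = m ∨ t = -m := by
  obtain ⟨z, rfl⟩ := ZMod.intCast_surjective t
  obtain ⟨q, rfl⟩ := three_mul_intCast_eq_zero_iff.1 ht
  have hm := three_mul_natCast_eq_zero (m := m)
  obtain ⟨p, rfl | rfl | rfl⟩ : ∃ p, q = 3 * p ∨ q = 3 * p + 1 ∨ q = 3 * p - 1 :=
    ⟨(q + 1) / 3, by omega⟩
  · left; push_cast; linear_combination (p : ZMod (3 * m)) * hm
  · right; left; push_cast; linear_combination (p : ZMod (3 * m)) * hm
  · right; right; push_cast; linear_combination (p : ZMod (3 * m)) * hm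

theorem nonempty_mulEquiv_B_of_isUnit_add [NeZero m] (hs : IsUnit (k + l : ZMod (3 * m)))
    (h3 : 3 * (k : ZMod (3 * m)) = 0) (hk : (k : ZMod (3 * m)) ≠ 0) :
    Nonempty (CyclicGroup (3 * m) (word (3 * m) k l) ≃*
      B |J (3 * m)| 3 ((-2) ^ (2 * m)) 1) := by
  obtain ⟨u, hu⟩ := hs.exists_left_inv
  have hku : (k : ZMod (3 * m)) = k * u * (k + l) := by linear_combination -(k : ZMod (3 * m)) * hu
  rcases eq_zero_or_eq_or_eq_neg_of_three_mul_eq_zero (t := (k : ZMod (3 * m)) * u)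
    (by linear_combination u * h3) with ht | ht | ht <;> rw [ht] at hku
  · exact absurd (hku.trans (zero_mul _)) hk
  · exact nonempty_mulEquiv_B_of_eq_natCast_mul hs hku
  · obtain ⟨e⟩ := nonempty_mulEquiv_inv (n := 3 * m) k l
    have hsum : ((-k : ℤ) + (l - k : ℤ) : ZMod (3 * m)) = k + l := by
      push_cast; linear_combination -h3
    refine (nonempty_mulEquiv_B_of_eq_natCast_mul (k := -k) (l := l - k) (by rwa [hsum]) ?_).map
      e.trans
    rw [hsum]; push_cast; linear_combination -hku

theorem three_dvd_of_three_mul_eq_zero {t : ZMod n} (ht : 3 * t = 0) (h : t ≠ 0) : 3 ∣ n := by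
  contrapose! h
  rw [← Nat.prime_three.coprime_iff_not_dvd] at h
  have hunit : IsUnit (3 : ZMod n) := by exact_mod_cast (ZMod.isUnit_iff_coprime 3 n).2 h
  exact hunit.mul_right_eq_zero.1 ht

theorem nonempty_mulEquiv_B [NeZero n] (hkl : IsCoprime (k : ZMod n) (l : ZMod n))
    (h3 : 3 * k ≡ 0 [ZMOD n]) (hk : ¬k ≡ 0 [ZMOD n]) (hA : ¬CondA n k l) :
    Nonempty (CyclicGroup n (word n k l) ≃*
      B ((2 ^ n - (-1) ^ n) / 3) 3 (2 ^ (2 * n / 3)) 1) := by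
  rw [← ZMod.intCast_eq_intCast_iff] at h3 hk
  push_cast at h3 hk
  obtain ⟨m, rfl⟩ := three_dvd_of_three_mul_eq_zero h3 hk
  have : NeZero m := ⟨right_ne_zero_of_mul (NeZero.ne (3 * m))⟩
  have hs : ¬k + l ≡ 0 [ZMOD 3] := fun hs =>
    hA ⟨Int.modEq_zero_iff_dvd.2 (by exact_mod_cast dvd_mul_right 3 m), hs⟩
  have hexp : 2 * (3 * m) / 3 = 2 * m := by omega
  rw [two_pow_sub_neg_one_pow_div_three, hexp, ← (even_two_mul m).neg_pow]
  exact nonempty_mulEquiv_B_of_isUnit_add (isUnit_add hkl h3 hs) h3 hk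

theorem nonempty_mulEquiv_cyc [NeZero n] (hkl : IsCoprime (k : ZMod n) (l : ZMod n))
    (hk : k ≡ 0 [ZMOD n]) :
    Nonempty (CyclicGroup n (word n k l) ≃* Cyc (2 ^ n - (-1) ^ n : ℤ).toNat) := by
  rw [two_pow_sub_neg_one_pow, Int.abs_eq_natAbs, Int.toNat_natCast]
  rw [← ZMod.intCast_eq_intCast_iff] at hk
  exact nonempty_mulEquiv_cyc_natAbs hkl (mod_cast hk)

theorem nonempty_mulEquiv_cycCoprod [NeZero n] (hkl : IsCoprime (k : ZMod n) (l : ZMod n))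
    (h3 : 3 * k ≡ 0 [ZMOD n]) (hA : CondA n k l) :
    Nonempty (CyclicGroup n (word n k l) ≃*
      CycCoprod ((2 ^ (n / 3) - (-1) ^ (n / 3)) / 3 : ℤ).toNat) := by
  obtain ⟨m, rfl⟩ : 3 ∣ n := by exact_mod_cast Int.modEq_zero_iff_dvd.1 hA.1
  have : NeZero m := ⟨right_ne_zero_of_mul (NeZero.ne (3 * m))⟩
  rw [Nat.mul_div_cancel_left m three_pos, two_pow_sub_neg_one_pow_div_three, Int.abs_eq_natAbs,
    Int.toNat_natCast]
  rw [← ZMod.intCast_eq_intCast_iff] at h3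
  exact nonempty_mulEquiv_cycCoprod_natAbs hkl (mod_cast h3) hA.2

/-- The pairs `(k', l')` obtained from `(k, l)` by rotating the relators `x_i x_{i+k} x_{i+l}`
cyclically. -/
inductive IsRotation (k l : ℤ) : ℤ → ℤ → Prop
  | refl : IsRotation k l k l
  | step {k' l' : ℤ} : IsRotation k l k' l' → IsRotation k l (l' - k') (-k')

theorem exists_isRotation {d : ℤ}
    (h : d * l ≡ 0 [ZMOD n] ∨ d * k ≡ 0 [ZMOD n] ∨ d * (l - k) ≡ 0 [ZMOD n]) :
    ∃ k' l', IsRotation k l k' l' ∧ d * k' ≡ 0 [ZMOD n] := by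
  simp only [← ZMod.intCast_eq_intCast_iff] at h ⊢
  push_cast at h ⊢
  rcases h with h | h | h
  · exact ⟨_, _, .step (.step .refl), by push_cast; linear_combination -h⟩
  · exact ⟨_, _, .refl, h⟩
  · exact ⟨_, _, .step .refl, mod_cast h⟩

namespace IsRotation

variable {k' l' : ℤ}

theorem nonempty_mulEquiv [NeZero n] (h : IsRotation k l k' l') :
    Nonempty (CyclicGroup n (word n k l) ≃* CyclicGroup n (word n k' l')) := by
  induction h with
  | refl => exact ⟨MulEquiv.refl _⟩
  | step _ ih =>
    obtain ⟨e⟩ := ih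
    exact (nonempty_mulEquiv_rotate _ _).map e.trans

theorem isCoprime (h : IsRotation k l k' l') (hkl : IsCoprime (k : ZMod n) (l : ZMod n)) :
    IsCoprime (k' : ZMod n) (l' : ZMod n) := by
  induction h with
  | refl => exact hkl
  | @step k' l' _ ih =>
    obtain ⟨u, v, huv⟩ := ih
    exact ⟨v, -u - v, by push_cast; linear_combination huv⟩

theorem condA_iff (h : IsRotation k l k' l') : CondA n k' l' ↔ CondA n k l := by
  induction h with
  | refl => rfl
  | step _ ih => rw [← ih, CondA, CondA, Int.ModEq, Int.ModEq, Int.ModEq]; omega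

theorem degenerate_iff (h : IsRotation k l k' l') :
    (k' ≡ 0 [ZMOD n] ∨ l' ≡ 0 [ZMOD n] ∨ k' ≡ l' [ZMOD n]) ↔
      (k ≡ 0 [ZMOD n] ∨ l ≡ 0 [ZMOD n] ∨ k ≡ l [ZMOD n]) := by
  induction h with
  | refl => rfl
  | step _ ih =>
    rw [← ih]
    simp only [← ZMod.intCast_eq_intCast_iff]
    push_cast
    grind

end IsRotation

theorem isCoprime_intCast (h : n.gcd (k.gcd l) = 1) : IsCoprime (k : ZMod n) (l : ZMod n) := by
  have hunit : IsUnit ((k.gcd l : ℕ) : ZMod n) :=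
    (ZMod.isUnit_iff_coprime _ n).2 (Nat.Coprime.symm h)
  obtain ⟨u, hu⟩ := hunit.exists_left_inv
  have hbezout := congrArg (Int.cast (R := ZMod n)) (Int.gcd_eq_gcd_ab k l)
  push_cast at hbezout
  exact ⟨u * k.gcdA l, u * k.gcdB l, by linear_combination hu - u * hbezout⟩

end Reduction

end CyclicPres

open CyclicPres

theorem corollaryD (n : ℕ) (hn : 0 < n) (k l : ℤ)
    (hgcd : Nat.gcd n (Int.gcd k l) = 1) (hC : CyclicPres.CondC n k l) :
    (¬ CyclicPres.CondA n k l → ¬ k ≡ 0 [ZMOD n] → ¬ l ≡ 0 [ZMOD n] → ¬ k ≡ l [ZMOD n] →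
      Nonempty (CyclicPres.CyclicGroup n (CyclicPres.word n k l) ≃*
        CyclicPres.B ((2 ^ n - (-1) ^ n) / 3) 3 (2 ^ (2 * n / 3)) 1)) ∧
    (k ≡ 0 [ZMOD n] ∨ l ≡ 0 [ZMOD n] ∨ k ≡ l [ZMOD n] →
      Nonempty (CyclicPres.CyclicGroup n (CyclicPres.word n k l) ≃*
        CyclicPres.Cyc ((2 ^ n - (-1) ^ n : ℤ).toNat))) ∧
    (CyclicPres.CondA n k l →
      Nonempty (CyclicPres.CyclicGroup n (CyclicPres.word n k l) ≃*
        Monoid.Coprod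
          (Monoid.Coprod (CyclicPres.Cyc (((2 ^ (n / 3) - (-1) ^ (n / 3)) / 3 : ℤ).toNat))
            (Multiplicative ℤ))
          (Multiplicative ℤ))) := by
  have : NeZero n := ⟨hn.ne'⟩
  have hkl := isCoprime_intCast hgcd
  obtain ⟨k', l', hrot, h3⟩ := exists_isRotation hC
  obtain ⟨e⟩ := hrot.nonempty_mulEquiv (n := n)
  refine ⟨fun hA hk hl hne => ?_, fun hdeg => ?_, fun hA => ?_⟩
  · have hk' : ¬k' ≡ 0 [ZMOD n] := fun h =>
      (hrot.degenerate_iff.1 (Or.inl h)).elim hk (Or.rec hl hne)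
    exact (nonempty_mulEquiv_B (hrot.isCoprime hkl) h3 hk' (hrot.condA_iff.not.2 hA)).map e.trans
  · obtain ⟨k₁, l₁, hrot₁, hk₁⟩ := exists_isRotation (n := n) (d := 1) (k := k) (l := l) <| by
      simpa [Int.modEq_iff_dvd, or_left_comm, dvd_sub_comm] using hdeg
    obtain ⟨e₁⟩ := hrot₁.nonempty_mulEquiv (n := n)
    rw [one_mul] at hk₁
    exact (nonempty_mulEquiv_cyc (hrot₁.isCoprime hkl) hk₁).map e₁.trans
  · exact (nonempty_mulEquiv_cycCoprod (hrot.isCoprime hkl) h3 (hrot.condA_iff.2 hA)).map e.trans
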